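/- Let $N\ge 2$ and $n=2^{N-1}$, and order the computational product basis $|0\cdots 0\rangle,|0\cdots 01\rangle,\dots,|1\cdots 1\rangle$ of $(\mathbb{C}^2)^{\otimes N}$ in binary order. Call an $N$-qubit density matrix $\hat X$ (positive semidefinite, trace $1$) an X-matrix if all its entries off the diagonal and off the anti-diagonal in this basis vanish. Let $a_1,\dots,a_n$ be the first $n$ diagonal entries of $\hat X$, $b_1,\dots,b_n$ the last $n$ diagonal entries read from the last one upwards, and $z_i=\hat X_{i,\,2n+1-i}$ for $1\le i\le n$ the entries in the upper half of the anti-diagonal. For a unit vector $|\psi\rangle$ define $$C_{GM}(|\psi\rangle)=\min_{S}\sqrt{2}\,\sqrt{1-\mathrm{Tr}(\rho_S^2)},$$ where the minimum is over all bipartitions $S\,|\,S^c$ of the $N$ qubits into two non-empty parts and $\rho_S$ is the reduced density matrix of $|\psi\rangle\langle\psi|$ on the qubits in $S$ (the choice of the part does not affect the purity). For a density matrix $\hat\rho$ define $$C_{GM}(\hat\rho)=\inf\sum_i p_i\,C_{GM}(|\psi_i\rangle),$$ where the infimum is over all finite pure state decompositions $\hat\rho=\sum_i p_i|\psi_i\rangle\langle\psi_i|$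 with $p_i\ge 0$, $\sum_i p_i=1$ and unit vectors $|\psi_i\rangle$. Then for every $N$-qubit X-matrix $\hat X$ the infimum defining $C_{GM}(\hat X)$ is attained, i.e. is a minimum, and $$C_{GM}(\hat X)=2\max_{1\le i\le n}\max\{0,\,|z_i|-w_i\},\qquad w_i=\sum_{j\ne i}\sqrt{a_j b_j}.$$ -/

import Mathlib

open scoped ComplexOrder

/-- Labels of the computational product basis of `N` qubits: `x k` is the bit of qubit `k`. -/
abbrev Config (N : ℕ) : Type := Fin N → Fin 2

/-- The bit-flipped basis label. -/
def flipBits {N : ℕ} (x : Config N) : Config N := fun k => (x k).rev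

/-- Unit vectors of the `N`-qubit Hilbert space, in coordinates. -/
def IsPureState {N : ℕ} (ψ : Config N → ℂ) : Prop := ∑ x, ‖ψ x‖ ^ 2 = 1

/-- Density matrices: positive semidefinite (hence Hermitian) with unit trace. -/
def IsDensityMatrix {N : ℕ} (ρ : Matrix (Config N) (Config N) ℂ) : Prop :=
  ρ.PosSemidef ∧ ρ.trace = 1

/-- The projector `|ψ⟩⟨ψ|`. -/
def ketBra {N : ℕ} (ψ : Config N → ℂ) : Matrix (Config N) (Config N) ℂ :=
  Matrix.vecMulVec ψ (star ψ)

/-- The basis label that is `u` on the qubits in `S` and `t` on the others. -/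
def glue {N : ℕ} (S : Finset (Fin N)) (u : {k // k ∈ S} → Fin 2) (t : {k // k ∉ S} → Fin 2) :
    Config N :=
  fun k => if h : k ∈ S then u ⟨k, h⟩ else t ⟨k, h⟩

/-- The reduced matrix on the qubits in `S`: the other qubits are traced out. -/
def reducedMatrix {N : ℕ} (S : Finset (Fin N)) (ρ : Matrix (Config N) (Config N) ℂ) :
    Matrix ({k // k ∈ S} → Fin 2) ({k // k ∈ S} → Fin 2) ℂ :=
  Matrix.of fun u v => ∑ t : {k // k ∉ S} → Fin 2, ρ (glue S u t) (glue S v t)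

/-- The purity `Tr (ρ_S ^ 2)` of the reduced state of `ψ` on the qubits in `S`. -/
noncomputable def purity {N : ℕ} (S : Finset (Fin N)) (ψ : Config N → ℂ) : ℝ :=
  (Matrix.trace (reducedMatrix S (ketBra ψ) * reducedMatrix S (ketBra ψ))).re

/-- A bipartition `S | Sᶜ` of the qubits into two non-empty parts, given by one of its parts.
Each bipartition occurs twice, as `S` and as `Sᶜ`, which does not affect a minimum over all
bipartitions, as the two reduced states of a pure state have equal purity. -/
abbrev Bipartition (N : ℕ) : Type := {S : Finset (Fin N) // S.Nonempty ∧ Sᶜ.Nonempty}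

/-- GM concurrence of a pure state: the minimum over the (finitely many) bipartitions. -/
noncomputable def pureGMConcurrence {N : ℕ} (ψ : Config N → ℂ) : ℝ :=
  ⨅ S : Bipartition N, √2 * √(1 - purity S.1 ψ)

/-- The average pure-state GM concurrences of all (finite) pure state decompositions of `ρ`. -/
def decompositionAverages {N : ℕ} (ρ : Matrix (Config N) (Config N) ℂ) : Set ℝ :=
  {c | ∃ (m : ℕ) (p : Fin m → ℝ) (ψ : Fin m → Config N → ℂ),
    (∀ i, 0 ≤ p i) ∧ ∑ i, p i = 1 ∧ (∀ i, IsPureState (ψ i)) ∧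
    ρ = ∑ i, (p i : ℂ) • ketBra (ψ i) ∧
    c = ∑ i, p i * pureGMConcurrence (ψ i)}

/-- GM concurrence of a mixed state (convex roof). -/
noncomputable def gmConcurrence {N : ℕ} (ρ : Matrix (Config N) (Config N) ℂ) : ℝ :=
  sInf (decompositionAverages ρ)

/-- All non-zero entries are on the diagonal or on the anti-diagonal. In the binary ordering of
the basis, the anti-diagonal consists of the pairs `(x, flipBits x)`. -/
def IsXMatrix {N : ℕ} (ρ : Matrix (Config N) (Config N) ℂ) : Prop :=
  ∀ x y, y ≠ x → y ≠ flipBits x → ρ x y = 0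

/-- The first half of the basis in the binary ordering: the leading bit is `0`. For `N ≥ 1` it has
`2 ^ (N - 1)` elements. -/
def upperHalf (N : ℕ) : Finset (Config N) :=
  Finset.univ.filter fun x => ∀ k : Fin N, (k : ℕ) = 0 → x k = 0

theorem upperHalf_nonempty (N : ℕ) : (upperHalf N).Nonempty :=
  ⟨0, by simp [upperHalf]⟩

/-- The upper diagonal entry `a_i` (for `i` in the upper half). -/
def entryA {N : ℕ} (ρ : Matrix (Config N) (Config N) ℂ) (i : Config N) : ℝ := (ρ i i).re

/-- The lower diagonal entry `b_i`. -/
def entryB {N : ℕ} (ρ : Matrix (Config N) (Config N) ℂ) (i : Config N) : ℝ :=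
  (ρ (flipBits i) (flipBits i)).re

/-- The upper anti-diagonal entry `z_i`. -/
def entryZ {N : ℕ} (ρ : Matrix (Config N) (Config N) ℂ) (i : Config N) : ℂ := ρ i (flipBits i)

/-- `w_i = ∑_{j ≠ i} √(a_j b_j)`, with `j` in the upper half. -/
noncomputable def entryW {N : ℕ} (ρ : Matrix (Config N) (Config N) ℂ) (i : Config N) : ℝ :=
  ∑ j ∈ (upperHalf N).erase i, √(entryA ρ j * entryB ρ j)

/-!
For a unit vector `ψ`, the concurrence across a bipartition is the `ℓ²` norm of the family of
`2 × 2` minors of the amplitude matrix (`sqrt_two_mul_sqrt_one_sub_purity`). Below, `w i` stands for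
`entryW ρ i`, and `flipBits i` is the label on the other side of the anti-diagonal.

*Lower bound.* Across any bipartition there is one minor of the form
`ψ i * ψ (flipBits i) - ψ j * ψ (flipBits j)` with `j ∉ {i, flipBits i}`. It occurs four times, so
the concurrence of `ψ` is at least twice its modulus, and hence at least
`2 * (‖ψ i‖ * ‖ψ (flipBits i)‖ - ∑ j ≠ i, ‖ψ j‖ * ‖ψ (flipBits j)‖)`. Averaged over a decomposition
of `ρ`, the first term dominates `|z i|` and the sum is at most `w i` by Cauchy–Schwarz
(`two_mul_max_le_of_mem_decompositionAverages`).

*Upper bound.* A vector supported on `x`, `y` and their flips is a product across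
`{k | x k = y k}` as soon as `ψ x * ψ (flipBits x) = ψ y * ψ (flipBits y)`. This fixes only sums of
phases, so averages of such vectors produce any two blocks with equal products of diagonal entries
and admissible anti-diagonal entries (`hasDecompositionOfCost_xBlock_add_xBlock`). If `|z i| ≤ w i`
for all `i`, the numbers `r i = min (√(a i * b i)) (w i)` satisfy the polygon inequality, so they
are the degrees of a weighted graph on the blocks (`exists_weights_of_polygon`). Sharing each block
out among its edges shows that `ρ` is a mixture of biseparable states
(`hasDecompositionOfCost_sum_xBlock_zero`). If `|z k| > w k` for some `k`, subtracting a single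
vector on `k` and `flipBits k` of total concurrence `2 * (|z k| - w k)` leaves a matrix of the
previous kind (`hasDecompositionOfCost_sum_xBlock_of_lt`).
-/

/-! ### Basis labels -/

variable {N : ℕ}

theorem flipBits_flipBits (x : Config N) : flipBits (flipBits x) = x := by
  funext k; simp [flipBits]

theorem Fin.rev_ne_self_of_two (a : Fin 2) : a.rev ≠ a := by
  revert a; decide

theorem Fin.eq_rev_of_ne_of_two {a b : Fin 2} (h : a ≠ b) : a = b.rev := by
  revert a b; decide

theorem flipBits_ne_self (hN : 0 < N) (x : Config N) : flipBits x ≠ x := fun h =>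
  Fin.rev_ne_self_of_two (x ⟨0, hN⟩) (congrFun h ⟨0, hN⟩)

theorem mem_upperHalf_iff (hN : 0 < N) (x : Config N) : x ∈ upperHalf N ↔ x ⟨0, hN⟩ = 0 := by
  simp only [upperHalf, Finset.mem_filter, Finset.mem_univ, true_and]
  refine ⟨fun h => h _ rfl, fun h k hk => ?_⟩
  rwa [show k = ⟨0, hN⟩ from Fin.ext hk]

theorem flipBits_mem_upperHalf_iff (hN : 0 < N) (x : Config N) :
    flipBits x ∈ upperHalf N ↔ x ∉ upperHalf N := by
  rw [mem_upperHalf_iff hN, mem_upperHalf_iff hN]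
  simp only [flipBits]
  generalize x ⟨0, hN⟩ = a
  revert a; decide

theorem sum_eq_sum_upperHalf (hN : 0 < N) {M : Type*} [AddCommMonoid M] (f : Config N → M) :
    ∑ x, f x = ∑ x ∈ upperHalf N, (f x + f (flipBits x)) := by
  rw [← Finset.sum_add_sum_compl (upperHalf N), Finset.sum_add_distrib]
  congr 1
  refine Finset.sum_nbij' flipBits flipBits ?_ ?_ ?_ ?_ ?_
  · intro x hx
    exact (flipBits_mem_upperHalf_iff hN x).2 (Finset.mem_compl.1 hx)
  · intro x hx
    rw [Finset.mem_compl, flipBits_mem_upperHalf_iff hN]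
    exact not_not.2 hx
  · intro x _; exact flipBits_flipBits x
  · intro x _; exact flipBits_flipBits x
  · intro x _; rw [flipBits_flipBits]

theorem sum_glue (S : Finset (Fin N)) {M : Type*} [AddCommMonoid M] (f : Config N → M) :
    ∑ u, ∑ t, f (glue S u t) = ∑ x, f x := by
  rw [← Fintype.sum_prod_type']
  exact Fintype.sum_equiv (Equiv.piEquivPiSubtypeProd (· ∈ S) (fun _ => Fin 2)).symm _ _
    (fun _ => rfl)

theorem glue_restrict (S : Finset (Fin N)) (x : Config N) :
    glue S (fun k => x k) (fun k => x k) = x := by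
  funext k; simp [glue]

/-! ### Minors and purity -/

/-- A form of Lagrange's identity: the purity deficit of `M * Mᴴ` is half the sum of the squared
moduli of the `2 × 2` minors of `M`. -/
theorem sum_norm_minor_sq {m n : Type*} [Fintype m] [Fintype n] (M : Matrix m n ℂ) :
    ∑ u, ∑ v, ∑ t, ∑ s, ‖M u t * M v s - M u s * M v t‖ ^ 2 =
      2 * ((∑ u, ∑ t, ‖M u t‖ ^ 2) ^ 2 -
        (Matrix.trace (M * M.conjTranspose * (M * M.conjTranspose))).re) := by
  have expand : ∀ a b c d : ℂ, ‖a * b - c * d‖ ^ 2 =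
      ‖a‖ ^ 2 * ‖b‖ ^ 2 + ‖c‖ ^ 2 * ‖d‖ ^ 2 - 2 * (a * star d * (b * star c)).re := by
    intro a b c d
    simp only [← Complex.normSq_eq_norm_sq, Complex.normSq_apply, Complex.sub_re, Complex.sub_im,
      Complex.mul_re, Complex.mul_im, RCLike.star_def, Complex.conj_re, Complex.conj_im]
    ring
  have h1 : ∑ u, ∑ v, ∑ t, ∑ s, ‖M u t‖ ^ 2 * ‖M v s‖ ^ 2 = (∑ u, ∑ t, ‖M u t‖ ^ 2) ^ 2 := by
    simp only [sq (∑ u, ∑ t, ‖M u t‖ ^ 2), Finset.sum_mul_sum]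
  have h2 : ∑ u, ∑ v, ∑ t, ∑ s, ‖M u s‖ ^ 2 * ‖M v t‖ ^ 2 = (∑ u, ∑ t, ‖M u t‖ ^ 2) ^ 2 := by
    rw [← h1]
    exact Finset.sum_congr rfl fun u _ => Finset.sum_congr rfl fun v _ => Finset.sum_comm
  have h3 : ∑ u, ∑ v, ∑ t, ∑ s, 2 * (M u t * star (M v t) * (M v s * star (M u s))).re =
      2 * (Matrix.trace (M * M.conjTranspose * (M * M.conjTranspose))).re := by
    simp only [← Finset.mul_sum]
    simp only [Matrix.trace, Matrix.diag, Matrix.mul_apply, Matrix.conjTranspose_apply,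
      Finset.sum_mul_sum, Complex.re_sum]
  simp only [expand, Finset.sum_sub_distrib, Finset.sum_add_distrib]
  rw [h1, h2, h3]
  ring

/-- The amplitudes of `ψ` as a matrix with rows labelled by the qubits in `S` and columns by the
other qubits. -/
def amplitudeMatrix (S : Finset (Fin N)) (ψ : Config N → ℂ) :
    Matrix ({k // k ∈ S} → Fin 2) ({k // k ∉ S} → Fin 2) ℂ :=
  Matrix.of fun u t => ψ (glue S u t)

theorem reducedMatrix_ketBra (S : Finset (Fin N)) (ψ : Config N → ℂ) :
    reducedMatrix S (ketBra ψ) = amplitudeMatrix S ψ * (amplitudeMatrix S ψ).conjTranspose := by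
  ext u v
  simp [reducedMatrix, ketBra, amplitudeMatrix, Matrix.mul_apply, Matrix.vecMulVec_apply]

/-- For a unit vector, the concurrence across `S | Sᶜ` is the `ℓ²` norm of the family of all
`2 × 2` minors of the amplitude matrix. -/
theorem sqrt_two_mul_sqrt_one_sub_purity (S : Finset (Fin N)) {ψ : Config N → ℂ}
    (hψ : IsPureState ψ) :
    √2 * √(1 - purity S ψ) = √(∑ u, ∑ v, ∑ t, ∑ s, ‖amplitudeMatrix S ψ u t *
      amplitudeMatrix S ψ v s - amplitudeMatrix S ψ u s * amplitudeMatrix S ψ v t‖ ^ 2) := by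
  have h : ∑ u, ∑ t, ‖amplitudeMatrix S ψ u t‖ ^ 2 = 1 :=
    (sum_glue S fun x => ‖ψ x‖ ^ 2).trans hψ
  rw [← Real.sqrt_mul (by norm_num), sum_norm_minor_sq, h, purity, reducedMatrix_ketBra, one_pow]

theorem add_swap_le_sum_sum {m : Type*} [Fintype m] (f : m → m → ℝ)
    (hf : ∀ u v, 0 ≤ f u v) {u v : m} (huv : u ≠ v) : f u v + f v u ≤ ∑ a, ∑ b, f a b := by
  classical
  rw [← Fintype.sum_prod_type', ← Finset.sum_pair (f := fun p : m × m => f p.1 p.2)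
    (a := (u, v)) (b := (v, u)) (by simp [huv])]
  exact Finset.sum_le_sum_of_subset_of_nonneg (Finset.subset_univ _) fun p _ _ => hf _ _

/-- Each minor on distinct rows and columns occurs four times, up to sign. -/
theorem four_mul_norm_minor_sq_le {m n : Type*} [Fintype m] [Fintype n] (M : Matrix m n ℂ)
    {u v : m} {t s : n} (huv : u ≠ v) (hts : t ≠ s) :
    4 * ‖M u t * M v s - M u s * M v t‖ ^ 2 ≤
      ∑ u, ∑ v, ∑ t, ∑ s, ‖M u t * M v s - M u s * M v t‖ ^ 2 := by
  have key : ∀ a b : m, ‖M a t * M b s - M a s * M b t‖ ^ 2 +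
      ‖M a s * M b t - M a t * M b s‖ ^ 2 ≤ ∑ t, ∑ s, ‖M a t * M b s - M a s * M b t‖ ^ 2 :=
    fun a b => add_swap_le_sum_sum (fun t s => ‖M a t * M b s - M a s * M b t‖ ^ 2)
      (fun _ _ => by positivity) hts
  refine le_trans ?_ (add_swap_le_sum_sum
    (fun a b => ∑ t, ∑ s, ‖M a t * M b s - M a s * M b t‖ ^ 2) (fun _ _ => by positivity) huv)
  refine le_trans (le_of_eq ?_) (add_le_add (key u v) (key v u))
  rw [norm_sub_rev (M u s * M v t), mul_comm (M v t), mul_comm (M v s),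
    norm_sub_rev (M u s * M v t)]
  ring

/-- If `M` vanishes outside two rows and two columns, only one minor contributes. -/
theorem sum_norm_minor_sq_of_support {m n : Type*} [Fintype m] [Fintype n] (M : Matrix m n ℂ)
    {u v : m} {t s : n} (huv : u ≠ v) (hts : t ≠ s) (hrow : ∀ a b, a ≠ u → a ≠ v → M a b = 0)
    (hcol : ∀ a b, b ≠ t → b ≠ s → M a b = 0) :
    ∑ u, ∑ v, ∑ t, ∑ s, ‖M u t * M v s - M u s * M v t‖ ^ 2 =
      4 * ‖M u t * M v s - M u s * M v t‖ ^ 2 := by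
  have hin : ∀ a b : m, ∑ t, ∑ s, ‖M a t * M b s - M a s * M b t‖ ^ 2 =
      2 * ‖M a t * M b s - M a s * M b t‖ ^ 2 := by
    intro a b
    rw [Fintype.sum_eq_add t s hts, Fintype.sum_eq_add t s hts, Fintype.sum_eq_add t s hts,
      norm_sub_rev (M a s * M b t)]
    · simp [two_mul]
    all_goals
      rintro c ⟨hc1, hc2⟩
      simp [hcol _ c hc1 hc2]
  simp only [hin]
  rw [Fintype.sum_eq_add u v huv, Fintype.sum_eq_add u v huv, Fintype.sum_eq_add u v huv,
    mul_comm (M v t), mul_comm (M v s), norm_sub_rev (M u s * M v t)]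
  · rw [mul_comm (M u t) (M u s), mul_comm (M v t) (M v s)]
    simp
    ring
  all_goals
    rintro c ⟨hc1, hc2⟩
    simp [hrow c _ hc1 hc2]

/-! ### The lower bound -/

/-- A lower bound for pure states: across any bipartition, pairing the label `i` with the label
obtained from it by flipping the qubits outside `S` gives one `2 × 2` minor. -/
theorem two_mul_sub_le_pureGMConcurrence (hN : 2 ≤ N) {ψ : Config N → ℂ} (hψ : IsPureState ψ)
    (i : Config N) :
    2 * (‖ψ i‖ * ‖ψ (flipBits i)‖ -
      ∑ j ∈ (upperHalf N).erase i, ‖ψ j‖ * ‖ψ (flipBits j)‖) ≤ pureGMConcurrence ψ := by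
  have hN0 : 0 < N := by omega
  have : Nonempty (Bipartition N) :=
    ⟨⟨{⟨0, hN0⟩}, Finset.singleton_nonempty _, ⟨⟨1, by omega⟩, by simp⟩⟩⟩
  refine le_ciInf ?_
  rintro ⟨S, ⟨k, hk⟩, ⟨l, hl⟩⟩
  rw [Finset.mem_compl] at hl
  rw [sqrt_two_mul_sqrt_one_sub_purity S hψ]
  set j : Config N := glue S (fun k => i k) (fun k => flipBits i k) with hj
  have hfj : flipBits j = glue S (fun k => flipBits i k) (fun k => i k) := by
    funext m
    by_cases hm : m ∈ S <;> simp [hj, glue, flipBits, hm]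
  have hji : j ≠ i := fun h => Fin.rev_ne_self_of_two (i l) <| by
    simpa [hj, glue, hl, flipBits] using congrFun h l
  have hfji : flipBits j ≠ i := fun h => Fin.rev_ne_self_of_two (i k) <| by
    rw [hfj] at h
    simpa [glue, hk, flipBits] using congrFun h k
  have hle : ‖ψ j‖ * ‖ψ (flipBits j)‖ ≤
      ∑ j ∈ (upperHalf N).erase i, ‖ψ j‖ * ‖ψ (flipBits j)‖ := by
    by_cases hjH : j ∈ upperHalf N
    · exact Finset.single_le_sum (f := fun j => ‖ψ j‖ * ‖ψ (flipBits j)‖)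
        (fun _ _ => by positivity) (Finset.mem_erase.2 ⟨hji, hjH⟩)
    · have := Finset.single_le_sum (f := fun j => ‖ψ j‖ * ‖ψ (flipBits j)‖)
        (s := (upperHalf N).erase i) (fun _ _ => by positivity)
        (Finset.mem_erase.2 ⟨hfji, (flipBits_mem_upperHalf_iff hN0 j).2 hjH⟩)
      rwa [flipBits_flipBits, mul_comm] at this
  have hmin := four_mul_norm_minor_sq_le (amplitudeMatrix S ψ)
    (u := fun k => i k) (v := fun k => flipBits i k)
    (t := fun k => i k) (s := fun k => flipBits i k)
    (fun h => Fin.rev_ne_self_of_two _ (congrFun h ⟨k, hk⟩).symm)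
    (fun h => Fin.rev_ne_self_of_two _ (congrFun h ⟨l, hl⟩).symm)
  refine le_trans ?_ (Real.le_sqrt_of_sq_le ((mul_pow 2 _ 2).trans_le (by norm_num; exact hmin)))
  simp only [amplitudeMatrix, Matrix.of_apply, glue_restrict, ← hj, ← hfj]
  have := norm_sub_norm_le (ψ i * ψ (flipBits i)) (ψ j * ψ (flipBits j))
  rw [norm_mul, norm_mul] at this
  linarith

theorem pureGMConcurrence_nonneg (ψ : Config N → ℂ) : 0 ≤ pureGMConcurrence ψ :=
  Real.iInf_nonneg fun _ => by positivity

/-- The lower bound for mixed states: the pure-state bound is averaged with the triangle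
inequality for the anti-diagonal entry and Cauchy–Schwarz for the others. -/
theorem two_mul_max_le_of_mem_decompositionAverages (hN : 2 ≤ N)
    {ρ : Matrix (Config N) (Config N) ℂ} {c : ℝ} (hc : c ∈ decompositionAverages ρ)
    (i : Config N) : 2 * max 0 (‖entryZ ρ i‖ - entryW ρ i) ≤ c := by
  obtain ⟨m, p, ψ, hp, -, hψ, hρ, rfl⟩ := hc
  have happ : ∀ x y, ρ x y = ∑ k, (p k : ℂ) * (ψ k x * star (ψ k y)) := by
    intro x y
    simp [hρ, Matrix.sum_apply, ketBra, Matrix.vecMulVec_apply]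
  have hdiag : ∀ x, (ρ x x).re = ∑ k, p k * ‖ψ k x‖ ^ 2 := by
    intro x
    rw [happ, Complex.re_sum]
    refine Finset.sum_congr rfl fun k _ => ?_
    rw [RCLike.star_def, Complex.mul_conj, Complex.normSq_eq_norm_sq, ← Complex.ofReal_mul,
      Complex.ofReal_re]
  have hz : ‖entryZ ρ i‖ ≤ ∑ k, p k * (‖ψ k i‖ * ‖ψ k (flipBits i)‖) := by
    rw [entryZ, happ]
    refine (norm_sum_le _ _).trans (le_of_eq (Finset.sum_congr rfl fun k _ => ?_))
    rw [norm_mul, norm_mul, norm_star, Complex.norm_real, Real.norm_of_nonneg (hp k)]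
  have hw : ∑ j ∈ (upperHalf N).erase i, ∑ k, p k * (‖ψ k j‖ * ‖ψ k (flipBits j)‖) ≤
      entryW ρ i := by
    refine Finset.sum_le_sum fun j _ => ?_
    rw [entryA, entryB, hdiag, hdiag, Real.sqrt_mul (Finset.sum_nonneg fun k _ =>
      mul_nonneg (hp k) (sq_nonneg _))]
    refine le_trans (le_of_eq (Finset.sum_congr rfl fun k _ => ?_))
      (Real.sum_sqrt_mul_sqrt_le Finset.univ (fun k => mul_nonneg (hp k) (sq_nonneg _))
        (fun k => mul_nonneg (hp k) (sq_nonneg _)))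
    rw [Real.sqrt_mul (hp k), Real.sqrt_mul (hp k), Real.sqrt_sq (norm_nonneg _),
      Real.sqrt_sq (norm_nonneg _), mul_mul_mul_comm, Real.mul_self_sqrt (hp k)]
  rw [mul_max_of_nonneg _ _ zero_le_two, mul_zero]
  refine max_le (Finset.sum_nonneg fun k _ => mul_nonneg (hp k) (pureGMConcurrence_nonneg _)) ?_
  calc 2 * (‖entryZ ρ i‖ - entryW ρ i)
      ≤ 2 * (∑ k, p k * (‖ψ k i‖ * ‖ψ k (flipBits i)‖) -
          ∑ j ∈ (upperHalf N).erase i, ∑ k, p k * (‖ψ k j‖ * ‖ψ k (flipBits j)‖)) := by linarith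
    _ = ∑ k, p k * (2 * (‖ψ k i‖ * ‖ψ k (flipBits i)‖ -
          ∑ j ∈ (upperHalf N).erase i, ‖ψ k j‖ * ‖ψ k (flipBits j)‖)) := by
        rw [Finset.sum_comm, ← Finset.sum_sub_distrib, Finset.mul_sum]
        refine Finset.sum_congr rfl fun k _ => ?_
        rw [← Finset.mul_sum]
        ring
    _ ≤ ∑ k, p k * pureGMConcurrence (ψ k) := Finset.sum_le_sum fun k _ =>
        mul_le_mul_of_nonneg_left (two_mul_sub_le_pureGMConcurrence hN (hψ k) i) (hp k)

/-! ### Unnormalized decompositions -/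

/-- `ρ`, not necessarily of unit trace, has a decomposition `∑ i, p i • |ψ i⟩⟨ψ i|` into pure
states with weights `p i ≥ 0` and total GM concurrence `∑ i, p i * C (ψ i)` at most `v`. The
weights need not add up to `1`, so that such decompositions can be added and scaled. -/
def HasDecompositionOfCost (ρ : Matrix (Config N) (Config N) ℂ) (v : ℝ) : Prop :=
  ∃ (m : ℕ) (p : Fin m → ℝ) (ψ : Fin m → Config N → ℂ),
    (∀ i, 0 ≤ p i) ∧ (∀ i, IsPureState (ψ i)) ∧ ρ = ∑ i, (p i : ℂ) • ketBra (ψ i) ∧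
    ∑ i, p i * pureGMConcurrence (ψ i) ≤ v

namespace HasDecompositionOfCost

variable {ρ σ : Matrix (Config N) (Config N) ℂ} {v w : ℝ}

theorem mono (h : HasDecompositionOfCost ρ v) (hvw : v ≤ w) : HasDecompositionOfCost ρ w := by
  obtain ⟨m, p, ψ, hp, hψ, hρ, hv⟩ := h
  exact ⟨m, p, ψ, hp, hψ, hρ, hv.trans hvw⟩

theorem zero : HasDecompositionOfCost (0 : Matrix (Config N) (Config N) ℂ) 0 :=
  ⟨0, Fin.elim0, Fin.elim0, fun i => i.elim0, fun i => i.elim0, by simp, by simp⟩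

theorem add (hρ : HasDecompositionOfCost ρ v) (hσ : HasDecompositionOfCost σ w) :
    HasDecompositionOfCost (ρ + σ) (v + w) := by
  obtain ⟨m, p, ψ, hp, hψ, rfl, hv⟩ := hρ
  obtain ⟨n, q, φ, hq, hφ, rfl, hw⟩ := hσ
  refine ⟨m + n, Fin.append p q, Fin.append ψ φ, fun i => ?_, fun i => ?_, ?_, ?_⟩
  · refine Fin.addCases (fun j => ?_) (fun j => ?_) i <;> simp [hp, hq]
  · refine Fin.addCases (fun j => ?_) (fun j => ?_) i <;> simp [hψ, hφ]
  · simp [Fin.sum_univ_add]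
  · simpa [Fin.sum_univ_add] using add_le_add hv hw

theorem sum {ι : Type*} (s : Finset ι) {f : ι → Matrix (Config N) (Config N) ℂ}
    (h : ∀ i ∈ s, HasDecompositionOfCost (f i) 0) : HasDecompositionOfCost (∑ i ∈ s, f i) 0 := by
  refine Finset.sum_induction f (HasDecompositionOfCost · 0) (fun a b ha hb => ?_) zero h
  simpa using ha.add hb

theorem smul (h : HasDecompositionOfCost ρ v) {r : ℝ} (hr : 0 ≤ r) :
    HasDecompositionOfCost ((r : ℂ) • ρ) (r * v) := by
  obtain ⟨m, p, ψ, hp, hψ, rfl, hv⟩ := h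
  refine ⟨m, fun i => r * p i, ψ, fun i => mul_nonneg hr (hp i), hψ, ?_, ?_⟩
  · simp only [Finset.smul_sum, smul_smul, Complex.ofReal_mul]
  · simpa only [mul_assoc, ← Finset.mul_sum] using mul_le_mul_of_nonneg_left hv hr

theorem exists_mem_decompositionAverages (h : HasDecompositionOfCost ρ v) (htr : ρ.trace = 1) :
    ∃ c ∈ decompositionAverages ρ, c ≤ v := by
  obtain ⟨m, p, ψ, hp, hψ, hρ, hv⟩ := h
  refine ⟨_, ⟨m, p, ψ, hp, ?_, hψ, hρ, rfl⟩, hv⟩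
  have hone : ∀ i, (ketBra (ψ i)).trace = 1 := by
    intro i
    have h := hψ i
    rw [IsPureState] at h
    simp only [Matrix.trace, Matrix.diag, ketBra, Matrix.vecMulVec_apply, Pi.star_apply,
      RCLike.star_def, Complex.mul_conj, Complex.normSq_eq_norm_sq, ← Complex.ofReal_sum, h,
      Complex.ofReal_one]
  rw [hρ, Matrix.trace_sum] at htr
  simp only [Matrix.trace_smul, hone, smul_eq_mul, mul_one] at htr
  exact_mod_cast htr

end HasDecompositionOfCost

/-- If `ψ` lives on the labels `x`, `y` and their flips, then across `S = {k | x k = y k}` its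
amplitude matrix has a single non-zero `2 × 2` block, so one minor gives the concurrence. -/
theorem pureGMConcurrence_le_of_support {ψ : Config N → ℂ} (hψ : IsPureState ψ) {x y : Config N}
    (hyx : y ≠ x) (hyx' : y ≠ flipBits x) (hsupp : ∀ w, w ≠ x → w ≠ flipBits x → w ≠ y →
      w ≠ flipBits y → ψ w = 0) :
    pureGMConcurrence ψ ≤ 2 * ‖ψ x * ψ (flipBits x) - ψ y * ψ (flipBits y)‖ := by
  set S : Finset (Fin N) := Finset.univ.filter fun k => x k = y k with hS
  have hmem : ∀ k, k ∈ S ↔ x k = y k := by simp [hS]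
  obtain ⟨l, hl⟩ : ∃ l, l ∉ S := by
    by_contra! h
    exact hyx (funext fun k => ((hmem k).1 (h k)).symm)
  obtain ⟨k, hk⟩ : ∃ k, k ∈ S := by
    by_contra! h
    refine hyx' (funext fun k => Fin.eq_rev_of_ne_of_two fun hxy => h k ((hmem k).2 hxy.symm))
  have hrev : ∀ m, m ∉ S → y m = (x m).rev := fun m hm =>
    Fin.eq_rev_of_ne_of_two fun hxy => hm ((hmem m).2 hxy.symm)
  refine (ciInf_le ⟨0, ?_⟩ (⟨S, ⟨k, hk⟩, ⟨l, by simpa using hl⟩⟩ : Bipartition N)).trans ?_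
  · rintro _ ⟨T, rfl⟩
    positivity
  rw [sqrt_two_mul_sqrt_one_sub_purity S hψ]
  have hy : y = glue S (fun k => x k) (fun k => flipBits x k) := by
    funext m
    by_cases hm : m ∈ S
    · simp [glue, hm, (hmem m).1 hm]
    · simp [glue, hm, flipBits, hrev m hm]
  have hy' : flipBits y = glue S (fun k => flipBits x k) (fun k => x k) := by
    funext m
    by_cases hm : m ∈ S
    · simp [glue, hm, flipBits, (hmem m).1 hm]
    · simp [glue, hm, flipBits, hrev m hm]
  have hrow : ∀ (a : {k // k ∈ S} → Fin 2) (b : {k // k ∉ S} → Fin 2) (z : Config N),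
      glue S a b = z → a = fun k : {k // k ∈ S} => z k := by
    rintro a b _ rfl
    funext k
    simp [glue]
  have hcol : ∀ (a : {k // k ∈ S} → Fin 2) (b : {k // k ∉ S} → Fin 2) (z : Config N),
      glue S a b = z → b = fun k : {k // k ∉ S} => z k := by
    rintro a b _ rfl
    funext k
    simp only [glue, dif_neg k.2]
  have hyS : (fun k : {k // k ∈ S} => y k) = fun k : {k // k ∈ S} => x k :=
    funext fun k => ((hmem k).1 k.2).symm
  have hyS' : (fun k : {k // k ∈ S} => flipBits y k) = fun k : {k // k ∈ S} => flipBits x k :=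
    funext fun k => congrArg Fin.rev ((hmem k).1 k.2).symm
  have hyT : (fun k : {k // k ∉ S} => y k) = fun k : {k // k ∉ S} => flipBits x k :=
    funext fun k => hrev k k.2
  have hyT' : (fun k : {k // k ∉ S} => flipBits y k) = fun k : {k // k ∉ S} => x k :=
    funext fun k => by simp [flipBits, hrev k k.2]
  rw [sum_norm_minor_sq_of_support (amplitudeMatrix S ψ)
    (u := fun k => x k) (v := fun k => flipBits x k)
    (t := fun k => x k) (s := fun k => flipBits x k)
    (fun h => Fin.rev_ne_self_of_two _ (congrFun h ⟨k, hk⟩).symm)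
    (fun h => Fin.rev_ne_self_of_two _ (congrFun h ⟨l, hl⟩).symm)]
  · simp only [amplitudeMatrix, Matrix.of_apply, glue_restrict, ← hy, ← hy']
    refine (Real.sqrt_le_iff.2 ⟨by positivity, le_of_eq ?_⟩)
    ring
  · intro a b h1 h2
    refine hsupp _ (fun h => h1 (hrow _ _ _ h)) (fun h => h2 (hrow _ _ _ h))
      (fun h => h1 ((hrow _ _ _ h).trans hyS)) (fun h => h2 ((hrow _ _ _ h).trans hyS'))
  · intro a b h1 h2
    refine hsupp _ (fun h => h1 (hcol _ _ _ h)) (fun h => h2 (hcol _ _ _ h))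
      (fun h => h2 ((hcol _ _ _ h).trans hyT)) (fun h => h1 ((hcol _ _ _ h).trans hyT'))

/-- The cost of a single, not necessarily normalized, vector on `x`, `y` and their flips. -/
theorem hasDecompositionOfCost_ketBra {φ : Config N → ℂ} {x y : Config N}
    (hyx : y ≠ x) (hyx' : y ≠ flipBits x) (hsupp : ∀ w, w ≠ x → w ≠ flipBits x → w ≠ y →
      w ≠ flipBits y → φ w = 0) :
    HasDecompositionOfCost (ketBra φ) (2 * ‖φ x * φ (flipBits x) - φ y * φ (flipBits y)‖) := by
  set q : ℝ := ∑ w, ‖φ w‖ ^ 2 with hq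
  have hq0 : 0 ≤ q := Finset.sum_nonneg fun _ _ => by positivity
  rcases hq0.eq_or_lt with h0 | hpos
  · have hφ : φ = 0 := by
      funext w
      have := (Finset.sum_eq_zero_iff_of_nonneg fun _ _ => by positivity).1 h0.symm w
        (Finset.mem_univ w)
      simpa using this
    refine HasDecompositionOfCost.mono (v := 0) ?_ (by positivity)
    simpa [hφ, ketBra] using HasDecompositionOfCost.zero
  · have hsq : ((√q : ℝ) : ℂ) ≠ 0 := by
      exact_mod_cast (Real.sqrt_pos.2 hpos).ne'
    set ψ : Config N → ℂ := fun w => φ w / (√q : ℝ) with hψdef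
    have hss : ((√q : ℝ) : ℂ) * (√q : ℝ) = q := by
      rw [← Complex.ofReal_mul, Real.mul_self_sqrt hq0]
    have hqc : (q : ℂ) ≠ 0 := by exact_mod_cast hpos.ne'
    have hψ : IsPureState ψ := by
      simp only [IsPureState, hψdef, norm_div, div_pow, Complex.norm_real, Real.norm_eq_abs, sq_abs,
        Real.sq_sqrt hq0, ← Finset.sum_div, ← hq]
      exact div_self hpos.ne'
    refine ⟨1, fun _ => q, fun _ => ψ, fun _ => hq0, fun _ => hψ, ?_, ?_⟩
    · ext w w'
      simp only [ketBra, Matrix.vecMulVec_apply, Pi.star_apply, RCLike.star_def,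
        Finset.univ_unique, Finset.sum_singleton, Matrix.smul_apply, smul_eq_mul, hψdef, map_div₀,
        Complex.conj_ofReal, div_mul_div_comm, hss]
      field_simp
    · have h := pureGMConcurrence_le_of_support hψ hyx hyx'
        (fun w h1 h2 h3 h4 => by simp [hψdef, hsupp w h1 h2 h3 h4])
      have heq : ψ x * ψ (flipBits x) - ψ y * ψ (flipBits y) =
          (φ x * φ (flipBits x) - φ y * φ (flipBits y)) / (q : ℝ) := by
        simp only [hψdef, div_mul_div_comm, hss, sub_div]
      rw [heq, norm_div, Complex.norm_real, Real.norm_of_nonneg hq0] at h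
      simp only [Finset.univ_unique, Finset.sum_singleton]
      calc q * pureGMConcurrence ψ ≤ q * (2 * (_ / q)) := mul_le_mul_of_nonneg_left h hq0
        _ = _ := by field_simp

/-! ### Blocks on a label and its flip -/

/-- The vector with amplitude `α` on `x`, amplitude `β` on `flipBits x` and `0` elsewhere (for
`N ≥ 1`, when the two labels are distinct). -/
def pairVec (x : Config N) (α β : ℂ) : Config N → ℂ :=
  Pi.single x α + Pi.single (flipBits x) β

/-- The Hermitian matrix `!![a, z; star z, b]` on the basis labels `x` and `flipBits x`, with
zeros elsewhere. -/
def xBlock (x : Config N) (a b : ℝ) (z : ℂ) : Matrix (Config N) (Config N) ℂ :=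
  Matrix.single x x (a : ℂ) + Matrix.single (flipBits x) (flipBits x) (b : ℂ) +
    Matrix.single x (flipBits x) z + Matrix.single (flipBits x) x (star z)

theorem pairVec_apply_self (hN : 0 < N) (x : Config N) (α β : ℂ) : pairVec x α β x = α := by
  simp [pairVec, (flipBits_ne_self hN x).symm]

theorem pairVec_apply_flipBits (hN : 0 < N) (x : Config N) (α β : ℂ) :
    pairVec x α β (flipBits x) = β := by
  simp [pairVec, flipBits_ne_self hN x]

theorem pairVec_apply_of_ne {x w : Config N} (h : w ≠ x) (h' : w ≠ flipBits x) (α β : ℂ) :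
    pairVec x α β w = 0 := by
  simp [pairVec, h, h']

theorem vecMulVec_single_star_single (x y : Config N) (α β : ℂ) :
    Matrix.vecMulVec (Pi.single x α) (star (Pi.single y β)) = Matrix.single x y (α * star β) := by
  ext w w'
  by_cases h : w = x
  · subst h
    by_cases h' : w' = y
    · subst h'
      simp [Matrix.vecMulVec_apply]
    · simp [Matrix.vecMulVec_apply, h', Matrix.single_apply_of_ne, Ne.symm h']
  · simp [Matrix.vecMulVec_apply, h, Matrix.single_apply_of_ne, Ne.symm h]

theorem ketBra_pairVec (x : Config N) (α β : ℂ) :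
    ketBra (pairVec x α β) = xBlock x (‖α‖ ^ 2) (‖β‖ ^ 2) (α * star β) := by
  have h : ∀ c : ℂ, c * star c = ((‖c‖ ^ 2 : ℝ) : ℂ) := fun c => by
    rw [RCLike.star_def, Complex.mul_conj, Complex.normSq_eq_norm_sq]
  simp only [ketBra, pairVec, star_add, Matrix.vecMulVec_add, Matrix.add_vecMulVec,
    vecMulVec_single_star_single, xBlock, h, star_mul, star_star]
  rw [mul_comm β]
  abel

theorem xBlock_add (x : Config N) (a b a' b' : ℝ) (z z' : ℂ) :
    xBlock x a b z + xBlock x a' b' z' = xBlock x (a + a') (b + b') (z + z') := by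
  simp only [xBlock, Complex.ofReal_add, star_add, Matrix.single_add]
  abel

theorem smul_xBlock (r : ℝ) (x : Config N) (a b : ℝ) (z : ℂ) :
    (r : ℂ) • xBlock x a b z = xBlock x (r * a) (r * b) (r * z) := by
  simp only [xBlock, smul_add, Matrix.smul_single, smul_eq_mul, Complex.ofReal_mul, star_mul',
    RCLike.star_def, Complex.conj_ofReal]

theorem exists_ne_and_ne_flipBits (hN : 2 ≤ N) (x : Config N) :
    ∃ y : Config N, y ≠ x ∧ y ≠ flipBits x := by
  refine ⟨Function.update x ⟨0, by omega⟩ (x ⟨0, by omega⟩).rev, fun h => ?_, fun h => ?_⟩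
  · have := congrFun h ⟨0, by omega⟩
    rw [Function.update_self] at this
    exact Fin.rev_ne_self_of_two _ this
  · have := congrFun h ⟨1, by omega⟩
    rw [Function.update_of_ne (by simp)] at this
    exact Fin.rev_ne_self_of_two _ this.symm

theorem hasDecompositionOfCost_ketBra_pairVec (hN : 2 ≤ N) (x : Config N) (α β : ℂ) :
    HasDecompositionOfCost (ketBra (pairVec x α β)) (2 * ‖α * β‖) := by
  obtain ⟨y, hy, hy'⟩ := exists_ne_and_ne_flipBits hN x
  have h := hasDecompositionOfCost_ketBra (φ := pairVec x α β) hy hy'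
    (fun w h1 h2 _ _ => pairVec_apply_of_ne h1 h2 α β)
  rwa [pairVec_apply_self (by omega), pairVec_apply_flipBits (by omega),
    pairVec_apply_of_ne hy hy', zero_mul, sub_zero] at h

theorem hasDecompositionOfCost_xBlock_diagonal (hN : 2 ≤ N) (x : Config N) {a b : ℝ}
    (ha : 0 ≤ a) (hb : 0 ≤ b) : HasDecompositionOfCost (xBlock x a b 0) 0 := by
  have h := (hasDecompositionOfCost_ketBra_pairVec hN x (√a : ℝ) 0).add
    (hasDecompositionOfCost_ketBra_pairVec hN x 0 (√b : ℝ))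
  rw [ketBra_pairVec, ketBra_pairVec, xBlock_add] at h
  simpa [Real.sq_sqrt ha, Real.sq_sqrt hb] using h

/-- A vector on `x`, `y` and their flips is a product across a suitable bipartition when the two
products of amplitudes agree. Averaging over the relative sign of the two pairs removes the
entries that couple one pair to the other. -/
theorem hasDecompositionOfCost_pairVec_add_pairVec (hN : 0 < N) {x y : Config N}
    (hyx : y ≠ x) (hyx' : y ≠ flipBits x) {α β γ δ : ℂ} (h : α * β = γ * δ) :
    HasDecompositionOfCost (ketBra (pairVec x α β) + ketBra (pairVec y γ δ)) 0 := by
  have hxy : x ≠ flipBits y := fun h => hyx' (by rw [h, flipBits_flipBits])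
  have hxy' : flipBits x ≠ flipBits y := fun h => hyx <| by
    rw [← flipBits_flipBits y, ← h, flipBits_flipBits]
  have hxy'' : flipBits y ≠ x := fun h => hxy h.symm
  have key : ∀ s : ℂ, s ^ 2 = 1 →
      HasDecompositionOfCost (ketBra (pairVec x α β + s • pairVec y γ δ)) 0 := by
    intro s hs
    have h1 := hasDecompositionOfCost_ketBra (φ := pairVec x α β + s • pairVec y γ δ) hyx hyx'
      (fun w h1 h2 h3 h4 => by
        simp [pairVec_apply_of_ne h1 h2, pairVec_apply_of_ne h3 h4])
    refine h1.mono (le_of_eq ?_)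
    simp only [Pi.add_apply, Pi.smul_apply, pairVec_apply_self hN, pairVec_apply_flipBits hN,
      pairVec_apply_of_ne hyx hyx', pairVec_apply_of_ne hyx.symm hxy,
      pairVec_apply_of_ne hyx'.symm hxy', pairVec_apply_of_ne hxy'' hxy'.symm, smul_eq_mul,
      mul_zero, add_zero, zero_add]
    rw [show α * β - s * γ * (s * δ) = α * β - s ^ 2 * (γ * δ) by ring, hs, h]
    simp
  have hsum := ((key 1 (by norm_num)).add (key (-1) (by norm_num))).smul (r := 1 / 2) (by norm_num)
  have heq : ((1 / 2 : ℝ) : ℂ) • (ketBra (pairVec x α β + (1 : ℂ) • pairVec y γ δ) +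
      ketBra (pairVec x α β + (-1 : ℂ) • pairVec y γ δ)) =
      ketBra (pairVec x α β) + ketBra (pairVec y γ δ) := by
    ext w w'
    simp only [ketBra, Matrix.smul_apply, Matrix.add_apply, Matrix.vecMulVec_apply, Pi.star_apply,
      Pi.add_apply, Pi.smul_apply, smul_eq_mul, star_add, star_mul', star_neg, star_one]
    push_cast
    ring
  rw [heq] at hsum
  simpa using hsum

/-- Two blocks with equal products of diagonal entries and extremal anti-diagonal entries: the
sum of the phases of a pair of amplitudes must agree between the blocks, but the differences,
which are the phases of the anti-diagonal entries, are free. -/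
theorem hasDecompositionOfCost_xBlock_add_xBlock_of_norm_eq_one (hN : 0 < N) {x y : Config N}
    (hyx : y ≠ x) (hyx' : y ≠ flipBits x) {a b a' b' : ℝ} (ha : 0 ≤ a) (hb : 0 ≤ b)
    (ha' : 0 ≤ a') (hb' : 0 ≤ b') (hab : a * b = 1) (hab' : a' * b' = 1) {u v : ℂ}
    (hu : ‖u‖ = 1) (hv : ‖v‖ = 1) :
    HasDecompositionOfCost (xBlock x a b u + xBlock y a' b' v) 0 := by
  -- The amplitudes are `(√a, √b * star u)` and `(√a' * t, √b' * t * star v)`; their products agree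
  -- exactly when `t ^ 2 = star u * v`.
  obtain ⟨t, ht⟩ := IsAlgClosed.exists_pow_nat_eq (star u * v) (n := 2) (by norm_num)
  have htn : ‖t‖ = 1 := by
    have h := congrArg norm ht
    rw [norm_pow, norm_mul, norm_star, hu, hv, one_mul] at h
    exact (pow_eq_one_iff_of_nonneg (norm_nonneg t) two_ne_zero).1 h
  have hs : ((√a : ℝ) : ℂ) * (√b : ℝ) = 1 := by
    rw [← Complex.ofReal_mul, ← Real.sqrt_mul ha, hab, Real.sqrt_one, Complex.ofReal_one]
  have hs' : ((√a' : ℝ) : ℂ) * (√b' : ℝ) = 1 := by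
    rw [← Complex.ofReal_mul, ← Real.sqrt_mul ha', hab', Real.sqrt_one, Complex.ofReal_one]
  have hunit : ∀ c : ℂ, ‖c‖ = 1 → c * star c = 1 := fun c hc => by
    rw [RCLike.star_def, Complex.mul_conj, Complex.normSq_eq_norm_sq, hc]
    norm_num
  have h := hasDecompositionOfCost_pairVec_add_pairVec hN hyx hyx'
    (α := (√a : ℝ)) (β := (√b : ℝ) * star u) (γ := (√a' : ℝ) * t)
    (δ := (√b' : ℝ) * (t * star v)) (by
      rw [show ((√a : ℝ) : ℂ) * ((√b : ℝ) * star u) = ((√a : ℝ) * (√b : ℝ)) * star u by ring, hs,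
        show ((√a' : ℝ) : ℂ) * t * ((√b' : ℝ) * (t * star v)) =
          ((√a' : ℝ) * (√b' : ℝ)) * t ^ 2 * star v by ring, hs', ht, one_mul, one_mul, mul_assoc,
        hunit v hv, mul_one])
  rw [ketBra_pairVec, ketBra_pairVec] at h
  have e1 : ((√a : ℝ) : ℂ) * star ((√b : ℝ) * star u) = u := by
    rw [star_mul', star_star, RCLike.star_def, Complex.conj_ofReal, ← mul_assoc, hs, one_mul]
  have e2 : ((√a' : ℝ) : ℂ) * t * star ((√b' : ℝ) * (t * star v)) = v := by
    rw [star_mul', star_mul', star_star, RCLike.star_def, Complex.conj_ofReal, ← RCLike.star_def,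
      show ((√a' : ℝ) : ℂ) * t * ((√b' : ℝ) * (star t * v)) =
        ((√a' : ℝ) * (√b' : ℝ)) * (t * star t) * v by ring, hs', hunit t htn, one_mul, one_mul]
  rw [e1, e2] at h
  simpa [hu, hv, htn, Real.sq_sqrt, ha, hb, ha', hb'] using h

theorem exists_norm_eq_one_add_div_two {z : ℂ} (hz : ‖z‖ ≤ 1) :
    ∃ u v : ℂ, ‖u‖ = 1 ∧ ‖v‖ = 1 ∧ z = (u + v) / 2 := by
  obtain ⟨w, hw, hzw⟩ : ∃ w : ℂ, ‖w‖ = 1 ∧ z = ‖z‖ * w := by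
    rcases eq_or_ne z 0 with rfl | h
    · exact ⟨1, by simp, by simp⟩
    · have h' : (‖z‖ : ℂ) ≠ 0 := by simpa using h
      exact ⟨z / ‖z‖, by simp [h], by field_simp⟩
  -- `u` and `v` are the ends of the chord of the unit circle through `z` orthogonal to `w`.
  have hs : √(1 - ‖z‖ ^ 2) ^ 2 = 1 - ‖z‖ ^ 2 :=
    Real.sq_sqrt (by nlinarith [norm_nonneg z])
  have hn : ∀ r s : ℝ, r ^ 2 + s ^ 2 = 1 → ‖(r + s * Complex.I : ℂ) * w‖ = 1 := by
    intro r s h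
    rw [norm_mul, hw, mul_one, Complex.norm_add_mul_I, h, Real.sqrt_one]
  refine ⟨(‖z‖ + (√(1 - ‖z‖ ^ 2) : ℝ) * Complex.I) * w,
    (‖z‖ + (-√(1 - ‖z‖ ^ 2) : ℝ) * Complex.I) * w, hn _ _ (by rw [hs]; ring),
    hn _ _ (by rw [neg_sq, hs]; ring), ?_⟩
  nth_rewrite 1 [hzw]
  push_cast
  ring

/-- Averaging over the phases of extremal anti-diagonal entries reaches all smaller entries. -/
theorem hasDecompositionOfCost_xBlock_add_xBlock (hN : 0 < N) {x y : Config N}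
    (hyx : y ≠ x) (hyx' : y ≠ flipBits x) {a b a' b' : ℝ} (ha : 0 ≤ a) (hb : 0 ≤ b)
    (ha' : 0 ≤ a') (hb' : 0 ≤ b') (hab : a * b = 1) (hab' : a' * b' = 1) {z z' : ℂ}
    (hz : ‖z‖ ≤ 1) (hz' : ‖z'‖ ≤ 1) :
    HasDecompositionOfCost (xBlock x a b z + xBlock y a' b' z') 0 := by
  obtain ⟨u, v, hu, hv, rfl⟩ := exists_norm_eq_one_add_div_two hz
  obtain ⟨u', v', hu', hv', rfl⟩ := exists_norm_eq_one_add_div_two hz'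
  have key := fun {u v : ℂ} => hasDecompositionOfCost_xBlock_add_xBlock_of_norm_eq_one hN hyx hyx'
    ha hb ha' hb' hab hab' (u := u) (v := v)
  have h := ((key hu hu').add (key hv hv')).smul (r := 1 / 2) (by norm_num)
  rw [add_add_add_comm, xBlock_add, xBlock_add, smul_add, smul_xBlock, smul_xBlock] at h
  convert h using 1
  · congr 2 <;> push_cast <;> ring
  · norm_num

/-! ### Weighted graphs with prescribed degrees -/

theorem exists_between_sum_eq {ι : Type*} (s : Finset ι) {l r : ι → ℝ} (hlr : ∀ i ∈ s, l i ≤ r i)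
    {b : ℝ} (hl : ∑ i ∈ s, l i ≤ b) (hr : b ≤ ∑ i ∈ s, r i) :
    ∃ d : ι → ℝ, (∀ i ∈ s, l i ≤ d i ∧ d i ≤ r i) ∧ ∑ i ∈ s, d i = b := by
  obtain ⟨p, q, hp, hq, hpq, hb⟩ : b ∈ segment ℝ (∑ i ∈ s, l i) (∑ i ∈ s, r i) := by
    rw [segment_eq_Icc (hl.trans hr)]
    exact ⟨hl, hr⟩
  refine ⟨fun i => p * l i + q * r i, fun i hi => ?_, ?_⟩
  · obtain rfl : p = 1 - q := by linarith
    have := hlr i hi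
    constructor <;> nlinarith
  · simpa [Finset.sum_add_distrib, ← Finset.mul_sum] using hb

/-- The polygon inequality suffices for a weighted graph on `s` to have degrees `r`. The
weight of an edge `{i, j}` is `c i j + c j i`. By induction, a new vertex is joined to the others
so that the remaining degrees satisfy the polygon inequality again; for this, the edge to `j` needs
at least the weight `r j - (∑ i ∈ s, r i - r k) / 2`. -/
theorem exists_weights_of_polygon {ι : Type*} [DecidableEq ι] (s : Finset ι) (r : ι → ℝ)
    (hr : ∀ i ∈ s, 0 ≤ r i) (hpoly : ∀ i ∈ s, 2 * r i ≤ ∑ j ∈ s, r j) :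
    ∃ c : ι → ι → ℝ, (∀ i j, 0 ≤ c i j) ∧ (∀ i, c i i = 0) ∧
      ∀ i ∈ s, ∑ j ∈ s, (c i j + c j i) = r i := by
  induction s using Finset.induction_on generalizing r with
  | empty => exact ⟨fun _ _ => 0, by simp, by simp, by simp⟩
  | insert k s hk ih =>
    rw [Finset.sum_insert hk] at hpoly
    have hpk := hpoly k (Finset.mem_insert_self k s)
    have hrk := hr k (Finset.mem_insert_self k s)
    have hrs : ∀ i ∈ s, 0 ≤ r i := fun i hi => hr i (Finset.mem_insert_of_mem hi)
    set T : ℝ := ∑ j ∈ s, r j - r k with hT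
    have hT0 : 0 ≤ T := by linarith
    have hle : ∀ i ∈ s, max 0 (r i - T / 2) ≤ r i := fun i hi =>
      max_le (hrs i hi) (by linarith)
    have hsum : ∑ i ∈ s, max 0 (r i - T / 2) ≤ r k := by
      by_cases h0 : ∃ i ∈ s, T / 2 < r i
      · obtain ⟨i, hi, hTi⟩ := h0
        by_cases h1 : ∃ j ∈ s, j ≠ i ∧ T / 2 < r j
        · obtain ⟨j, hj, hji, hTj⟩ := h1
          -- Two vertices above the threshold `T / 2` already save `T / 2` each.
          have h2 : ∑ m ∈ ({i, j} : Finset ι), (r m - max 0 (r m - T / 2)) ≤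
              ∑ m ∈ s, (r m - max 0 (r m - T / 2)) := by
            refine Finset.sum_le_sum_of_subset_of_nonneg ?_ fun m hm _ => sub_nonneg.2 (hle m hm)
            intro m hm
            rcases Finset.mem_insert.1 hm with rfl | hm
            · exact hi
            · rwa [Finset.mem_singleton.1 hm]
          rw [Finset.sum_pair hji.symm, max_eq_right (by linarith), max_eq_right (by linarith),
            Finset.sum_sub_distrib] at h2
          linarith
        · push Not at h1
          rw [Finset.sum_eq_single_of_mem i hi fun j hj hji =>
            max_eq_left (by linarith [h1 j hj hji]), max_eq_right (by linarith)]
          linarith [hpoly i (Finset.mem_insert_of_mem hi)]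
      · push Not at h0
        rwa [Finset.sum_eq_zero fun i hi => max_eq_left (by linarith [h0 i hi])]
    obtain ⟨d, hd, hdk⟩ := exists_between_sum_eq s hle hsum (by linarith)
    obtain ⟨c, hc0, hcd, hc⟩ := ih (fun i => r i - d i) (fun i hi => sub_nonneg.2 (hd i hi).2)
      (fun i hi => by
        rw [Finset.sum_sub_distrib, hdk]
        linarith [(le_max_right _ _).trans (hd i hi).1])
    refine ⟨fun i j => if i = k then (if j ∈ s then d j else 0) else if j = k then 0 else c i j,
      fun i j => ?_, fun i => ?_, fun i hi => ?_⟩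
    · dsimp only
      split_ifs with _ h
      · exact (le_max_left _ _).trans (hd j h).1
      · exact le_rfl
      · exact le_rfl
      · exact hc0 i j
    · by_cases hi : i = k
      · simp [hi, hk]
      · simp [hi, hcd]
    · have hne : ∀ j ∈ s, j ≠ k := fun j hj h => hk (h ▸ hj)
      rw [Finset.sum_insert hk]
      rcases Finset.mem_insert.1 hi with rfl | hi
      · rw [← hdk]
        simp only [if_true, hk, if_false, add_zero, zero_add]
        refine Finset.sum_congr rfl fun j hj => ?_
        simp [hj, hne j hj]
      · have h := hc i hi
        simp only [hne i hi, if_false, if_true, hi, zero_add]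
        rw [Finset.sum_congr rfl fun j hj => by rw [if_neg (hne j hj), if_neg (hne j hj)], h]
        ring

/-! ### Decompositions of X-matrices -/

/-- A sum of blocks with `|z i| ≤ r i ≤ √(a i * b i)`, where `r` satisfies the polygon inequality,
is a mixture of biseparable states: for a weighted graph with degrees `r`, each edge carries the
corresponding fractions of its two end blocks, and what remains is diagonal. -/
theorem hasDecompositionOfCost_sum_xBlock_of_polygon (hN : 2 ≤ N) {a b : Config N → ℝ}
    {z : Config N → ℂ} {r : Config N → ℝ} (ha : ∀ i ∈ upperHalf N, 0 ≤ a i)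
    (hb : ∀ i ∈ upperHalf N, 0 ≤ b i) (hzr : ∀ i ∈ upperHalf N, ‖z i‖ ≤ r i)
    (hrm : ∀ i ∈ upperHalf N, r i ≤ √(a i * b i))
    (hpoly : ∀ i ∈ upperHalf N, 2 * r i ≤ ∑ j ∈ upperHalf N, r j) :
    HasDecompositionOfCost (∑ i ∈ upperHalf N, xBlock i (a i) (b i) (z i)) 0 := by
  have hN0 : 0 < N := by omega
  have hr : ∀ i ∈ upperHalf N, 0 ≤ r i := fun i hi => (norm_nonneg _).trans (hzr i hi)
  obtain ⟨c, hc0, hcd, hc⟩ := exists_weights_of_polygon (upperHalf N) r hr hpoly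
  set m : Config N → ℝ := fun i => √(a i * b i) with hm
  have hm0 : ∀ i, 0 ≤ m i := fun i => Real.sqrt_nonneg _
  set U : Config N → Matrix (Config N) (Config N) ℂ :=
    fun i => xBlock i (a i / m i) (b i / m i) (z i / r i) with hU
  -- Where `r i = 0`, a quotient in `U i` may have denominator `0`; then `z i = 0` and the weight
  -- `r i` of `U i` vanishes, so that the splitting still holds.
  have hsplit : ∀ i ∈ upperHalf N, xBlock i (a i) (b i) (z i) = ((r i : ℝ) : ℂ) • U i +
      xBlock i (a i * (1 - r i / m i)) (b i * (1 - r i / m i)) 0 := by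
    intro i hi
    rw [hU, smul_xBlock, xBlock_add]
    congr 1
    · ring
    · ring
    · rcases eq_or_ne (r i) 0 with h | h
      · have : ‖z i‖ ≤ 0 := h ▸ hzr i hi
        simp [norm_le_zero_iff.1 this]
      · have : (r i : ℂ) ≠ 0 := by exact_mod_cast h
        field_simp
        ring
  have hedges : ∑ i ∈ upperHalf N, ((r i : ℝ) : ℂ) • U i =
      ∑ i ∈ upperHalf N, ∑ j ∈ upperHalf N, ((c i j : ℝ) : ℂ) • (U i + U j) := by
    simp only [smul_add, Finset.sum_add_distrib]
    rw [Finset.sum_comm (f := fun i j => ((c i j : ℝ) : ℂ) • U j), ← Finset.sum_add_distrib]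
    refine Finset.sum_congr rfl fun i hi => ?_
    rw [← Finset.sum_smul, ← Finset.sum_smul, ← add_smul, ← Finset.sum_add_distrib, ← hc i hi]
    push_cast
    rfl
  rw [Finset.sum_congr rfl hsplit, Finset.sum_add_distrib, hedges, ← zero_add (0 : ℝ)]
  refine .add (.sum _ fun i hi => .sum _ fun j hj => ?_) (.sum _ fun i hi => ?_)
  · rcases (hc0 i j).eq_or_lt with h0 | hpos
    · rw [← h0, Complex.ofReal_zero, zero_smul]
      exact .zero
    have hji : j ≠ i := by
      rintro rfl
      exact hpos.ne' (hcd j)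
    have hji' : j ≠ flipBits i := by
      rintro rfl
      exact (flipBits_mem_upperHalf_iff hN0 i).1 hj hi
    have hri : 0 < r i := by
      rw [← hc i hi]
      refine lt_of_lt_of_le (b := c i j + c j i) (by linarith [hc0 j i]) ?_
      exact Finset.single_le_sum (f := fun j => c i j + c j i)
        (fun j _ => add_nonneg (hc0 i j) (hc0 j i)) hj
    have hrj : 0 < r j := by
      rw [← hc j hj]
      refine lt_of_lt_of_le (b := c j i + c i j) (by linarith [hc0 j i]) ?_
      exact Finset.single_le_sum (f := fun i => c j i + c i j)
        (fun i _ => add_nonneg (hc0 j i) (hc0 i j)) hi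
    have hdiag : ∀ k ∈ upperHalf N, 0 < r k → a k / m k * (b k / m k) = 1 := by
      intro k hk hrk
      have hmk : 0 < m k := hrk.trans_le (hrm k hk)
      rw [div_mul_div_comm, hm, Real.mul_self_sqrt (mul_nonneg (ha k hk) (hb k hk))]
      exact div_self (Real.sqrt_pos.1 hmk).ne'
    have hoff : ∀ k ∈ upperHalf N, 0 < r k → ‖z k / r k‖ ≤ 1 := by
      intro k hk hrk
      rw [norm_div, Complex.norm_real, Real.norm_of_nonneg hrk.le]
      exact div_le_one_of_le₀ (hzr k hk) hrk.le
    have h := (hasDecompositionOfCost_xBlock_add_xBlock hN0 hji hji'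
      (div_nonneg (ha i hi) (hm0 i)) (div_nonneg (hb i hi) (hm0 i))
      (div_nonneg (ha j hj) (hm0 j)) (div_nonneg (hb j hj) (hm0 j))
      (hdiag i hi hri) (hdiag j hj hrj) (hoff i hi hri) (hoff j hj hrj)).smul hpos.le
    rwa [mul_zero] at h
  · have h1 : 0 ≤ 1 - r i / m i := sub_nonneg.2 (div_le_one_of_le₀ (hrm i hi) (hm0 i))
    exact hasDecompositionOfCost_xBlock_diagonal hN i (mul_nonneg (ha i hi) h1)
      (mul_nonneg (hb i hi) h1)

/-- An X-matrix all of whose anti-diagonal entries satisfy `|z i| ≤ w i` is a mixture of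
biseparable states. At most one `√(a i * b i)` violates the polygon inequality; truncating it to
`w i` gives suitable degrees. -/
theorem hasDecompositionOfCost_sum_xBlock_zero (hN : 2 ≤ N) {a b : Config N → ℝ}
    {z : Config N → ℂ} (ha : ∀ i ∈ upperHalf N, 0 ≤ a i) (hb : ∀ i ∈ upperHalf N, 0 ≤ b i)
    (hz : ∀ i ∈ upperHalf N, ‖z i‖ ≤ √(a i * b i))
    (hw : ∀ i ∈ upperHalf N, ‖z i‖ ≤ ∑ j ∈ (upperHalf N).erase i, √(a j * b j)) :
    HasDecompositionOfCost (∑ i ∈ upperHalf N, xBlock i (a i) (b i) (z i)) 0 := by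
  set m : Config N → ℝ := fun i => √(a i * b i) with hm
  have hm0 : ∀ i, 0 ≤ m i := fun i => Real.sqrt_nonneg _
  set w : Config N → ℝ := fun i => ∑ j ∈ (upperHalf N).erase i, m j with hwdef
  have hmw : ∀ i ∈ upperHalf N, m i + w i = ∑ j ∈ upperHalf N, m j :=
    fun i hi => Finset.add_sum_erase _ m hi
  refine hasDecompositionOfCost_sum_xBlock_of_polygon hN (r := fun i => min (m i) (w i)) ha hb
    (fun i hi => le_min (hz i hi) (hw i hi)) (fun i _ => min_le_left _ _) ?_
  by_cases h : ∃ k ∈ upperHalf N, w k < m k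
  · obtain ⟨k, hk, hkw⟩ := h
    have hle : ∀ j ∈ (upperHalf N).erase k, m j ≤ w k := fun j hj =>
      Finset.single_le_sum (f := m) (fun j _ => hm0 j) hj
    have hsum : ∑ j ∈ upperHalf N, min (m j) (w j) = 2 * w k := by
      rw [← Finset.add_sum_erase _ _ hk, min_eq_right hkw.le, two_mul]
      congr 1
      refine Finset.sum_congr rfl fun j hj => min_eq_left ?_
      linarith [hle j hj, hmw k hk, hmw j (Finset.mem_of_mem_erase hj)]
    intro i hi
    rw [hsum]
    refine mul_le_mul_of_nonneg_left ?_ zero_le_two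
    rcases eq_or_ne i k with rfl | hik
    · exact min_le_right _ _
    · exact (min_le_left _ _).trans (hle i (Finset.mem_erase.2 ⟨hik, hi⟩))
  · push Not at h
    intro i hi
    rw [Finset.sum_congr rfl fun j hj => min_eq_left (h j hj), min_eq_left (h i hi)]
    linarith [h i hi, hmw i hi]

/-- If `|z k|` exceeds `w k`, subtracting one pure state on `k` and its flip leaves an X-matrix
with `|z k| = w k`, to which the biseparable decomposition applies. -/
theorem hasDecompositionOfCost_sum_xBlock_of_lt (hN : 2 ≤ N) {a b : Config N → ℝ}
    {z : Config N → ℂ} (ha : ∀ i ∈ upperHalf N, 0 ≤ a i) (hb : ∀ i ∈ upperHalf N, 0 ≤ b i)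
    (hz : ∀ i ∈ upperHalf N, ‖z i‖ ≤ √(a i * b i)) {k : Config N} (hk : k ∈ upperHalf N)
    (hw : ∑ j ∈ (upperHalf N).erase k, √(a j * b j) < ‖z k‖) :
    HasDecompositionOfCost (∑ i ∈ upperHalf N, xBlock i (a i) (b i) (z i))
      (2 * (‖z k‖ - ∑ j ∈ (upperHalf N).erase k, √(a j * b j))) := by
  set m : Config N → ℝ := fun i => √(a i * b i) with hm
  have hm0 : ∀ i, 0 ≤ m i := fun i => Real.sqrt_nonneg _
  set w : ℝ := ∑ j ∈ (upperHalf N).erase k, m j with hwdef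
  have hw0 : 0 ≤ w := Finset.sum_nonneg fun j _ => hm0 j
  have hzk : 0 < ‖z k‖ := hw0.trans_lt hw
  have hmk : 0 < m k := hzk.trans_le (hz k hk)
  set t : ℝ := (‖z k‖ - w) / m k with ht
  have ht0 : 0 ≤ t := div_nonneg (sub_nonneg.2 hw.le) hmk.le
  have htm : t * m k = ‖z k‖ - w := div_mul_cancel₀ _ hmk.ne'
  have ht1 : t ≤ 1 := div_le_one_of_le₀ (by linarith [hz k hk]) hmk.le
  set e : ℂ := z k / ‖z k‖ with he
  have hzkc : (‖z k‖ : ℂ) ≠ 0 := by exact_mod_cast hzk.ne'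
  have hze : z k = ‖z k‖ * e := by rw [he]; field_simp
  have hen : ‖e‖ = 1 := by simp [he, hzk.ne']
  have hta : 0 ≤ t * a k := mul_nonneg ht0 (ha k hk)
  have htb : 0 ≤ t * b k := mul_nonneg ht0 (hb k hk)
  have hmul : √(t * a k) * √(t * b k) = ‖z k‖ - w := by
    rw [← Real.sqrt_mul hta, mul_mul_mul_comm, Real.sqrt_mul (mul_self_nonneg t),
      Real.sqrt_mul_self ht0]
    exact htm
  have hmulc : ((√(t * a k) : ℝ) : ℂ) * (√(t * b k) : ℝ) = (‖z k‖ - w : ℝ) := by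
    rw [← hmul, Complex.ofReal_mul]
  have hextra : HasDecompositionOfCost (xBlock k (t * a k) (t * b k) ((‖z k‖ - w : ℝ) * e))
      (2 * (‖z k‖ - w)) := by
    have h := hasDecompositionOfCost_ketBra_pairVec hN k (√(t * a k) : ℝ)
      ((√(t * b k) : ℝ) * star e)
    rw [ketBra_pairVec, star_mul', star_star, RCLike.star_def, Complex.conj_ofReal, ← mul_assoc,
      ← mul_assoc, hmulc] at h
    simpa only [norm_mul, RCLike.norm_conj, hen, mul_one, Complex.norm_real, Real.norm_eq_abs,
      sq_abs, Real.sq_sqrt hta, Real.sq_sqrt htb, abs_of_nonneg (sub_nonneg.2 hw.le)] using h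
  -- The remainder: `√(a i * b i)` and `|z i|` both drop by `‖z k‖ - w` at `i = k`.
  set a' : Config N → ℝ := Function.update a k ((1 - t) * a k) with ha'
  set b' : Config N → ℝ := Function.update b k ((1 - t) * b k) with hb'
  set z' : Config N → ℂ := Function.update z k (w * e) with hz'
  have hm'k : √(a' k * b' k) = m k - (‖z k‖ - w) := by
    rw [ha', hb', Function.update_self, Function.update_self, mul_mul_mul_comm,
      Real.sqrt_mul (mul_self_nonneg _), Real.sqrt_mul_self (sub_nonneg.2 ht1), ← htm]
    ring
  have hm' : ∀ j, j ≠ k → √(a' j * b' j) = m j := fun j hj => by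
    rw [ha', hb', Function.update_of_ne hj, Function.update_of_ne hj]
  have hz'k : ‖z' k‖ = w := by
    rw [hz', Function.update_self, norm_mul, hen, mul_one, Complex.norm_real,
      Real.norm_of_nonneg hw0]
  have hrest : HasDecompositionOfCost (∑ i ∈ upperHalf N, xBlock i (a' i) (b' i) (z' i)) 0 := by
    refine hasDecompositionOfCost_sum_xBlock_zero hN (fun i hi => ?_) (fun i hi => ?_)
      (fun i hi => ?_) (fun i hi => ?_)
    · rcases eq_or_ne i k with rfl | hik
      · rw [ha', Function.update_self]
        exact mul_nonneg (sub_nonneg.2 ht1) (ha i hi)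
      · rw [ha', Function.update_of_ne hik]
        exact ha i hi
    · rcases eq_or_ne i k with rfl | hik
      · rw [hb', Function.update_self]
        exact mul_nonneg (sub_nonneg.2 ht1) (hb i hi)
      · rw [hb', Function.update_of_ne hik]
        exact hb i hi
    · rcases eq_or_ne i k with rfl | hik
      · rw [hz'k, hm'k]
        linarith [hz i hi]
      · rw [hm' i hik, hz', Function.update_of_ne hik]
        exact hz i hi
    · rcases eq_or_ne i k with rfl | hik
      · rw [hz'k]
        exact le_of_eq (Finset.sum_congr rfl fun j hj => (hm' j (Finset.ne_of_mem_erase hj)).symm)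
      · rw [hz', Function.update_of_ne hik]
        have h1 : m i ≤ w := Finset.single_le_sum (f := m) (fun j _ => hm0 j)
          (Finset.mem_erase.2 ⟨hik, hi⟩)
        have h2 : √(a' k * b' k) ≤ ∑ j ∈ (upperHalf N).erase i, √(a' j * b' j) :=
          Finset.single_le_sum (f := fun j => √(a' j * b' j)) (fun j _ => Real.sqrt_nonneg _)
            (Finset.mem_erase.2 ⟨hik.symm, hk⟩)
        rw [hm'k] at h2
        linarith [hz i hi, hz k hk]
  have heq : ∑ i ∈ upperHalf N, xBlock i (a i) (b i) (z i) =
      xBlock k (t * a k) (t * b k) ((‖z k‖ - w : ℝ) * e) +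
        ∑ i ∈ upperHalf N, xBlock i (a' i) (b' i) (z' i) := by
    rw [← Finset.add_sum_erase _ _ hk, ← Finset.add_sum_erase _ _ hk, ← add_assoc, xBlock_add]
    congr 1
    · rw [ha', hb', hz', Function.update_self, Function.update_self, Function.update_self]
      congr 1
      · ring
      · ring
      · nth_rewrite 1 [hze]
        push_cast
        ring
    · refine Finset.sum_congr rfl fun j hj => ?_
      have hjk := Finset.ne_of_mem_erase hj
      rw [ha', hb', hz', Function.update_of_ne hjk, Function.update_of_ne hjk,
        Function.update_of_ne hjk]
  rw [heq]
  simpa using hextra.add hrest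

theorem IsXMatrix.eq_sum_xBlock (hN : 0 < N) {ρ : Matrix (Config N) (Config N) ℂ}
    (hρ : ρ.IsHermitian) (hX : IsXMatrix ρ) :
    ρ = ∑ i ∈ upperHalf N, xBlock i (entryA ρ i) (entryB ρ i) (entryZ ρ i) := by
  have h : ρ = ∑ x, (Matrix.single x x (ρ x x) +
      Matrix.single x (flipBits x) (ρ x (flipBits x))) := by
    conv_lhs => rw [Matrix.matrix_eq_sum_single ρ]
    refine Finset.sum_congr rfl fun x _ => ?_
    refine Fintype.sum_eq_add x (flipBits x) (flipBits_ne_self hN x).symm ?_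
    rintro y ⟨h1, h2⟩
    rw [hX x y h1 h2, Matrix.single_zero]
  conv_lhs => rw [h]
  rw [sum_eq_sum_upperHalf hN]
  refine Finset.sum_congr rfl fun x _ => ?_
  have hre : ∀ y, (((ρ y y).re : ℝ) : ℂ) = ρ y y := fun y => hρ.coe_re_apply_self y
  rw [xBlock, entryA, entryB, entryZ, hre, hre, flipBits_flipBits, hρ.apply]
  abel

theorem norm_entryZ_le {ρ : Matrix (Config N) (Config N) ℂ} (hρ : ρ.PosSemidef) (i : Config N) :
    ‖entryZ ρ i‖ ≤ √(entryA ρ i * entryB ρ i) := by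
  have hre : ∀ y, (((ρ y y).re : ℝ) : ℂ) = ρ y y := fun y => hρ.isHermitian.coe_re_apply_self y
  have h := (hρ.submatrix ![i, flipBits i]).det_nonneg
  rw [Matrix.det_fin_two] at h
  simp only [Matrix.submatrix_apply, Matrix.cons_val_zero, Matrix.cons_val_one] at h
  rw [← hρ.isHermitian.apply (flipBits i) i, RCLike.star_def, Complex.mul_conj, ← hre i,
    ← hre (flipBits i), ← Complex.ofReal_mul, ← Complex.ofReal_sub, Complex.zero_le_real,
    Complex.normSq_eq_norm_sq] at h
  exact Real.le_sqrt_of_sq_le (sub_nonneg.1 h)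

theorem mainTheorem1 (N : ℕ) (hN : 2 ≤ N) (ρ : Matrix (Config N) (Config N) ℂ)
    (hρ : IsDensityMatrix ρ) (hX : IsXMatrix ρ) :
    IsLeast (decompositionAverages ρ) (gmConcurrence ρ) ∧
    gmConcurrence ρ =
      2 * (upperHalf N).sup' (upperHalf_nonempty N)
        (fun i => max 0 (‖entryZ ρ i‖ - entryW ρ i)) := by
  set V : ℝ := 2 * (upperHalf N).sup' (upperHalf_nonempty N)
    (fun i => max 0 (‖entryZ ρ i‖ - entryW ρ i)) with hV
  have hterm : ∀ i ∈ upperHalf N, 2 * max 0 (‖entryZ ρ i‖ - entryW ρ i) ≤ V := fun i hi =>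
    mul_le_mul_of_nonneg_left
      (Finset.le_sup' (fun i => max 0 (‖entryZ ρ i‖ - entryW ρ i)) hi) zero_le_two
  have hlower : V ∈ lowerBounds (decompositionAverages ρ) := by
    intro c hc
    obtain ⟨i, -, h⟩ := Finset.exists_mem_eq_sup' (upperHalf_nonempty N)
      (fun i => max 0 (‖entryZ ρ i‖ - entryW ρ i))
    rw [hV, h]
    exact two_mul_max_le_of_mem_decompositionAverages hN hc i
  have hdiag : ∀ x, 0 ≤ (ρ x x).re := fun x => (Complex.nonneg_iff.1 hρ.1.diag_nonneg).1
  have hdec : HasDecompositionOfCost ρ V := by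
    rw [hX.eq_sum_xBlock (by omega) hρ.1.isHermitian]
    by_cases h : ∃ k ∈ upperHalf N, entryW ρ k < ‖entryZ ρ k‖
    · obtain ⟨k, hk, hlt⟩ := h
      refine (hasDecompositionOfCost_sum_xBlock_of_lt hN (fun i _ => hdiag i) (fun i _ => hdiag _)
        (fun i _ => norm_entryZ_le hρ.1 i) hk hlt).mono (le_trans ?_ (hterm k hk))
      exact mul_le_mul_of_nonneg_left (le_max_right _ _) zero_le_two
    · push Not at h
      obtain ⟨k, hk⟩ := upperHalf_nonempty N
      exact (hasDecompositionOfCost_sum_xBlock_zero hN (fun i _ => hdiag i) (fun i _ => hdiag _)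
        (fun i _ => norm_entryZ_le hρ.1 i) h).mono (le_trans (by positivity) (hterm k hk))
  obtain ⟨c, hc, hcV⟩ := hdec.exists_mem_decompositionAverages hρ.2
  have hcV' : c = V := le_antisymm hcV (hlower hc)
  have hleast : IsLeast (decompositionAverages ρ) V := ⟨hcV' ▸ hc, hlower⟩
  have hg : gmConcurrence ρ = V := hleast.csInf_eq
  exact ⟨hg.symm ▸ hleast, hg⟩
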